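/- Let $\mathbb D$ be the open unit disc, $\mathbb T$ the unit circle with normalized Lebesgue measure, and let $b$ be a non-constant holomorphic function on $\mathbb D$ with $|b|\le 1$ whose radial boundary values satisfy $\log(1-|b|)\in L^1(\mathbb T)$ (in particular $|b|<1$ a.e. on $\mathbb T$). Let $\mathcal H(b)$ be the de Branges–Rovnyak space, i.e. the reproducing kernel Hilbert space on $\mathbb D$ with kernel $$k^b_\lambda(z)=\frac{1-\overline{b(\lambda)}\,b(z)}{1-\overline{\lambda}z},\qquad \lambda,z\in\mathbb D.$$ For $\mu\in\mathbb D$ put $k_\mu(z)=\frac{1}{1-\overline{\mu}z}$, and for $A\subset\mathcal H(b)$ let $\operatorname{span}_{\mathcal H(b)}(A)$ be the closure in $\mathcal H(b)$ of the set of finite linear combinations of elements of $A$. Then multiplication by $z$ defines a (unique) bounded linear operator $S_b$ on $\mathcal H(b)$, $(S_bf)(z)=zf(z)$. For every $f\in\mathcal H(b)$ the functions $k_\mu f$, $\mu\in\mathbb D$, $|\mu|<1/\|S_b\|$, belong to $\mathcal H(b)$, and $$\operatorname{span}_{\mathcal H(b)}(z^nf:n\ge 0)=\operatorname{span}_{\mathcal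 H(b)}\Big(k_\mu f:\mu\in\mathbb D,\ |\mu|<\frac{1}{\|S_b\|}\Big).$$ In particular, $f$ is cyclic for $S_b$, i.e. $\operatorname{span}_{\mathcal H(b)}(S_b^nf:n\ge 0)=\mathcal H(b)$, if and only if $$\operatorname{span}_{\mathcal H(b)}\Big(k_\mu f:\mu\in\mathbb D,\ |\mu|<\frac{1}{\|S_b\|}\Big)=\mathcal H(b).$$ -/

import Mathlib

open Complex Metric Filter Topology
open scoped ComplexConjugate

noncomputable section

namespace DeBrangesRovnyak

/-- The closed unit ball of `H^∞`: functions holomorphic on the open unit disc and bounded by `1`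
there. (The values of `toFun` outside the open disc are never used.) -/
structure SchurFunction where
  toFun : ℂ → ℂ
  differentiableOn : DifferentiableOn ℂ toFun (ball 0 1)
  norm_le_one : ∀ z ∈ ball (0 : ℂ) 1, ‖toFun z‖ ≤ 1

instance : CoeFun SchurFunction (fun _ => ℂ → ℂ) := ⟨SchurFunction.toFun⟩

/-- `b` is not constant on the unit disc. -/
def SchurFunction.Nonconstant (b : SchurFunction) : Prop :=
  ∃ z w : UnitDisc, b z ≠ b w

/-- `log (1 - |b|) ∈ L¹(𝕋)`, where on `𝕋` the function `b` is given by its radial limits `β`.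
Since `Real.log 0 = 0`, the condition `|β| < 1` a.e. (which is implied by the integrability of the
extended-real-valued function `log (1 - |β|)`) is stated separately. -/
def SchurFunction.LogIntegrable (b : SchurFunction) : Prop :=
  ∃ β : ℂ → ℂ,
    (∀ᵐ θ : ℝ, Tendsto (fun r : ℝ => b (circleMap 0 r θ)) (𝓝[<] 1) (𝓝 (β (circleMap 0 1 θ)))) ∧
    (∀ᵐ θ : ℝ, ‖β (circleMap 0 1 θ)‖ < 1) ∧
    CircleIntegrable (fun ζ => Real.log (1 - ‖β ζ‖)) 0 1

/-- The Cauchy kernel `k_μ(z) = 1 / (1 - μ̄ z)`. -/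
def cauchyKernel (μ z : ℂ) : ℂ := 1 / (1 - conj μ * z)

/-- The kernel `(z, w) ↦ k_w^b(z) = (1 - conj (b w) b z) / (1 - w̄ z)` on the disc; the complex
number is viewed as an operator on `ℂ`, which is the format of `RKHS.kernel`. -/
def kernel (b : SchurFunction) : Matrix UnitDisc UnitDisc (ℂ →L[ℂ] ℂ) :=
  Matrix.of fun z w => ((1 - conj (b w) * b z) / (1 - conj (w : ℂ) * z)) • ContinuousLinearMap.id ℂ ℂ

/-! ### Positivity of the kernel -/

theorem one_sub_conj_mul_ne_zero (x : UnitDisc) {z : ℂ} (hz : ‖z‖ ≤ 1) :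
    1 - conj (x : ℂ) * z ≠ 0 := by
  intro h
  have h1 : ‖conj (x : ℂ) * z‖ = 1 := by
    rw [← sub_eq_zero.1 h]; simp
  rw [norm_mul, RCLike.norm_conj] at h1
  have := x.norm_lt_one
  nlinarith [norm_nonneg (x : ℂ), norm_nonneg z]

theorem differentiableOn_cauchyKernel (x : UnitDisc) :
    DifferentiableOn ℂ (cauchyKernel x) (closedBall 0 1) := by
  intro z hz
  unfold cauchyKernel
  refine DifferentiableAt.differentiableWithinAt ?_
  have := one_sub_conj_mul_ne_zero x (z := z) (by simpa using hz)
  fun_prop (disch := assumption)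

/-- The reproducing property of the Cauchy kernel on the unit circle. -/
theorem circleAverage_mul_conj_cauchyKernel {F : ℂ → ℂ}
    (hF : DifferentiableOn ℂ F (closedBall 0 1)) (x : UnitDisc) :
    Real.circleAverage (fun ζ => F ζ * conj (cauchyKernel x ζ)) 0 1 = F x := by
  have hF' : DiffContOnCl ℂ F (ball 0 |1|) := by
    rw [abs_one]
    exact DifferentiableOn.diffContOnCl (by rwa [closure_ball _ one_ne_zero])
  rw [← hF'.circleAverage_smul_div (w := (x : ℂ)) (by simpa using x.norm_lt_one)]
  refine Real.circleAverage_congr_sphere fun z hz => ?_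
  have hz1 : ‖z‖ = 1 := by simpa using hz
  have hzz : z * conj z = 1 := by simp [Complex.mul_conj, Complex.normSq_eq_norm_sq, hz1]
  have hzx : z - (x : ℂ) ≠ 0 := by
    intro h
    have := x.norm_lt_one
    rw [← sub_eq_zero.1 h] at this
    linarith
  have hne : 1 - (x : ℂ) * conj z ≠ 0 := by
    have := one_sub_conj_mul_ne_zero x hz1.le
    intro h
    apply this
    have := congrArg conj h
    simpa using this
  simp only [cauchyKernel, map_div₀, map_sub, map_mul, map_one, Complex.conj_conj, sub_zero,
    smul_eq_mul]
  field_simp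
  linear_combination (x : ℂ) * F z * hzz

theorem kernel_sum_re_nonneg_aux (s : Finset UnitDisc) (c : UnitDisc → ℂ) {B : ℂ → ℂ}
    (hB : DifferentiableOn ℂ B (closedBall 0 1)) (hB1 : ∀ z ∈ closedBall (0 : ℂ) 1, ‖B z‖ ≤ 1) :
    0 ≤ (∑ i ∈ s, ∑ j ∈ s,
      conj ((1 - conj (B i) * B j) / (1 - conj (i : ℂ) * j) * c i) * c j).re := by
  have hk := differentiableOn_cauchyKernel
  set h : ℂ → ℂ := fun ζ => ∑ i ∈ s, c i * cauchyKernel i ζ with hh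
  set g : ℂ → ℂ := fun ζ => ∑ i ∈ s, c i * conj (B i) * cauchyKernel i ζ with hg
  have hhD : DifferentiableOn ℂ h (closedBall 0 1) := by fun_prop
  have hgD : DifferentiableOn ℂ g (closedBall 0 1) := by fun_prop
  set F : UnitDisc → ℂ → ℂ := fun j ζ =>
    conj (c j) * h ζ + conj (c j) * B j * g ζ - 2 * conj (c j) * (B ζ * g ζ) with hF
  have hFD : ∀ j, DifferentiableOn ℂ (F j) (closedBall 0 1) := fun j => by fun_prop
  have hpt : ∀ ζ, ∑ j ∈ s, F j ζ * conj (cauchyKernel j ζ)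
      = h ζ * conj (h ζ) + g ζ * conj (g ζ) - 2 * (B ζ * g ζ) * conj (h ζ) := by
    intro ζ
    have e1 : conj (h ζ) = ∑ j ∈ s, conj (c j) * conj (cauchyKernel j ζ) := by
      simp [hh]
    have e2 : conj (g ζ) = ∑ j ∈ s, conj (c j) * B j * conj (cauchyKernel j ζ) := by
      simp [hg]
    rw [e1, e2, Finset.mul_sum, Finset.mul_sum, Finset.mul_sum, ← Finset.sum_add_distrib,
      ← Finset.sum_sub_distrib]
    refine Finset.sum_congr rfl fun j _ => ?_
    simp only [hF]
    ring
  have hci : ∀ j, CircleIntegrable (fun ζ => F j ζ * conj (cauchyKernel j ζ)) 0 1 := fun j => by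
    refine ContinuousOn.circleIntegrable zero_le_one ?_
    have h1 := ((hFD j).continuousOn).mono sphere_subset_closedBall
    have h2 := ((hk j).continuousOn).mono sphere_subset_closedBall
    exact h1.mul (Complex.continuous_conj.comp_continuousOn h2)
  have hav : Real.circleAverage
      (fun ζ => h ζ * conj (h ζ) + g ζ * conj (g ζ) - 2 * (B ζ * g ζ) * conj (h ζ)) 0 1
      = ∑ j ∈ s, F j j := by
    simp_rw [← hpt]
    rw [Real.circleAverage_fun_sum (fun j _ => hci j)]
    exact Finset.sum_congr rfl fun j _ => circleAverage_mul_conj_cauchyKernel (hFD j) j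
  have hint : CircleIntegrable
      (fun ζ => h ζ * conj (h ζ) + g ζ * conj (g ζ) - 2 * (B ζ * g ζ) * conj (h ζ)) 0 1 := by
    simp_rw [← hpt]
    exact CircleIntegrable.fun_sum _ (fun j _ => hci j)
  have hre : 0 ≤ (∑ j ∈ s, F j j).re := by
    rw [← hav]
    have := ContinuousLinearMap.circleAverage_comp_comm Complex.reCLM hint
    have h3 : (Real.circleAverage
        (fun ζ => h ζ * conj (h ζ) + g ζ * conj (g ζ) - 2 * (B ζ * g ζ) * conj (h ζ)) 0 1).re
        = Real.circleAverage (Complex.reCLM ∘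
          (fun ζ => h ζ * conj (h ζ) + g ζ * conj (g ζ) - 2 * (B ζ * g ζ) * conj (h ζ))) 0 1 :=
      this.symm
    rw [h3]
    refine Real.circleAverage_nonneg_of_nonneg fun ζ hζ => ?_
    have hBζ : ‖B ζ‖ ≤ 1 := hB1 ζ (sphere_subset_closedBall (by simpa using hζ))
    have hn : normSq (B ζ) ≤ 1 := by
      rw [Complex.normSq_eq_norm_sq]; nlinarith [norm_nonneg (B ζ)]
    have key : (h ζ * conj (h ζ) + g ζ * conj (g ζ) - 2 * (B ζ * g ζ) * conj (h ζ)).re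
        = normSq (h ζ - B ζ * g ζ) + (1 - normSq (B ζ)) * normSq (g ζ) := by
      simp only [Complex.normSq_apply, Complex.add_re, Complex.sub_re, Complex.mul_re,
        Complex.mul_im, Complex.conj_re, Complex.conj_im, Complex.re_ofNat, Complex.im_ofNat,
        Complex.sub_im]
      ring
    change 0 ≤ (h ζ * conj (h ζ) + g ζ * conj (g ζ) - 2 * (B ζ * g ζ) * conj (h ζ)).re
    rw [key]
    have := normSq_nonneg (h ζ - B ζ * g ζ)
    have := mul_nonneg (sub_nonneg.2 hn) (normSq_nonneg (g ζ))
    linarith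
  have hfin : (∑ i ∈ s, ∑ j ∈ s,
      conj ((1 - conj (B i) * B j) / (1 - conj (i : ℂ) * j) * c i) * c j)
      = conj (∑ j ∈ s, F j j) := by
    rw [Finset.sum_comm, map_sum]
    refine Finset.sum_congr rfl fun j _ => ?_
    simp only [hF, hh, hg, cauchyKernel]
    rw [← Complex.conj_conj (∑ i ∈ s, _)]
    congr 1
    simp only [Finset.mul_sum, ← Finset.sum_add_distrib, ← Finset.sum_sub_distrib, map_sum]
    refine Finset.sum_congr rfl fun i _ => ?_
    simp only [map_mul, Complex.conj_conj]
    ring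
  rw [hfin, Complex.conj_re]
  exact hre

theorem kernel_sum_re_nonneg (b : SchurFunction) (s : Finset UnitDisc) (c : UnitDisc → ℂ) :
    0 ≤ (∑ i ∈ s, ∑ j ∈ s,
      conj ((1 - conj (b i) * b j) / (1 - conj (i : ℂ) * j) * c i) * c j).re := by
  have hlim : ∀ x : UnitDisc, Tendsto (fun r : ℝ => b (r * x)) (𝓝[<] 1) (𝓝 (b x)) := by
    intro x
    have h1 : ContinuousAt b.toFun ((1 : ℝ) * (x : ℂ)) := by
      refine (b.differentiableOn.continuousOn).continuousAt (isOpen_ball.mem_nhds ?_)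
      simpa using x.norm_lt_one
    have h2 : Tendsto (fun r : ℝ => (r : ℂ) * (x : ℂ)) (𝓝[<] 1) (𝓝 ((1 : ℝ) * (x : ℂ))) := by
      refine Tendsto.mono_left ?_ nhdsWithin_le_nhds
      exact Continuous.tendsto (f := fun r : ℝ => (r : ℂ) * (x : ℂ)) (by fun_prop) 1
    have h3 := h1.tendsto.comp h2
    simpa [Function.comp_def] using h3
  have hT : Tendsto (fun r : ℝ => (∑ i ∈ s, ∑ j ∈ s,
      conj ((1 - conj (b (r * i)) * b (r * j)) / (1 - conj (i : ℂ) * j) * c i) * c j).re)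
      (𝓝[<] 1) (𝓝 (∑ i ∈ s, ∑ j ∈ s,
      conj ((1 - conj (b i) * b j) / (1 - conj (i : ℂ) * j) * c i) * c j).re) := by
    refine (Complex.continuous_re.tendsto _).comp ?_
    refine tendsto_finsetSum _ fun i _ => tendsto_finsetSum _ fun j _ => ?_
    refine Tendsto.mul_const _ ((Complex.continuous_conj.tendsto _).comp ?_)
    refine Tendsto.mul_const _ (Tendsto.div_const (Tendsto.const_sub _ ?_) _)
    exact ((Complex.continuous_conj.tendsto _).comp (hlim i)).mul (hlim j)
  refine ge_of_tendsto hT ?_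
  have hev : ∀ᶠ r : ℝ in 𝓝[<] 1, r ∈ Set.Ioo (0 : ℝ) 1 := Ioo_mem_nhdsLT zero_lt_one
  filter_upwards [hev] with r hr
  have hmem : ∀ z ∈ closedBall (0 : ℂ) 1, (r : ℂ) * z ∈ ball (0 : ℂ) 1 := by
    intro z hz
    have hz' : ‖z‖ ≤ 1 := by simpa using hz
    have : ‖(r : ℂ) * z‖ < 1 := by
      rw [norm_mul, Complex.norm_real, Real.norm_of_nonneg hr.1.le]
      nlinarith [hr.1, hr.2, norm_nonneg z]
    simpa using this
  refine kernel_sum_re_nonneg_aux s c (B := fun z => b (r * z)) ?_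
    fun z hz => b.norm_le_one _ (hmem z hz)
  exact b.differentiableOn.comp (by fun_prop) hmem

theorem isHermitian_kernel (b : SchurFunction) : (kernel b).IsHermitian := by
  refine Matrix.IsHermitian.ext fun z w => ?_
  have hid : star (ContinuousLinearMap.id ℂ ℂ) = ContinuousLinearMap.id ℂ ℂ :=
    star_one (ℂ →L[ℂ] ℂ)
  simp only [kernel, Matrix.of_apply, star_smul, hid]
  congr 1
  simp [mul_comm]

theorem posSemidef_kernel (b : SchurFunction) : (kernel b).PosSemidef := by
  have h : (kernel b).IsHermitian ∧ ∀ vv : UnitDisc →₀ ℂ,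
      0 ≤ RCLike.re (vv.sum fun x w => vv.sum fun x' w' => inner ℂ (kernel b x' x w) w') := by
    refine ⟨isHermitian_kernel b, fun vv => ?_⟩
    have := kernel_sum_re_nonneg b vv.support vv
    simpa [Finsupp.sum, kernel, mul_comm] using this
  exact (RKHS.posSemidef_tfae.out 0 2).mpr h

instance (b : SchurFunction) : Fact (kernel b).PosSemidef := ⟨posSemidef_kernel b⟩

/-- The de Branges–Rovnyak space `H(b)`: the reproducing kernel Hilbert space on the unit disc
with kernel `kernel b`. -/
def DBRSpace (b : SchurFunction) : Type := RKHS.OfKernel (kernel b)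

instance (b : SchurFunction) : NormedAddCommGroup (DBRSpace b) :=
  inferInstanceAs (NormedAddCommGroup (RKHS.OfKernel (kernel b)))

instance (b : SchurFunction) : InnerProductSpace ℂ (DBRSpace b) :=
  inferInstanceAs (InnerProductSpace ℂ (RKHS.OfKernel (kernel b)))

instance (b : SchurFunction) : CompleteSpace (DBRSpace b) :=
  inferInstanceAs (CompleteSpace (RKHS.OfKernel (kernel b)))

instance (b : SchurFunction) : RKHS ℂ (DBRSpace b) UnitDisc ℂ :=
  inferInstanceAs (RKHS ℂ (RKHS.OfKernel (kernel b)) UnitDisc ℂ)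

theorem kernel_DBRSpace (b : SchurFunction) : RKHS.kernel (DBRSpace b) = kernel b :=
  RKHS.OfKernel.kernel_ofKernel

/-- `S` is the shift operator `S_b` on `H(b)`, i.e. multiplication by the independent variable. -/
def IsShift {b : SchurFunction} (S : DBRSpace b →L[ℂ] DBRSpace b) : Prop :=
  ∀ (f : DBRSpace b) (z : UnitDisc), S f z = z * f z

/-- `g = φ f` as functions on the disc. -/
def IsMul {b : SchurFunction} (φ : ℂ → ℂ) (f g : DBRSpace b) : Prop :=
  ∀ z : UnitDisc, g z = φ z * f z

/-- The closed linear span in `H(b)`. -/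
def closedSpan {b : SchurFunction} (A : Set (DBRSpace b)) : Submodule ℂ (DBRSpace b) :=
  (Submodule.span ℂ A).topologicalClosure

/-- `f` is a cyclic vector of the operator `S`: the closed span of its orbit is the whole space. -/
def IsCyclicVector {b : SchurFunction} (S : DBRSpace b →L[ℂ] DBRSpace b) (f : DBRSpace b) : Prop :=
  closedSpan (Set.range fun n : ℕ => (S ^ n) f) = ⊤

end DeBrangesRovnyak

end

open DeBrangesRovnyak

/-! An operator sending each `k_w^b` to `w̄ k_w^b` has multiplication by `z` as its adjoint, so the
shift exists once this map is bounded on combinations of kernel functions. Expanding the kernel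
gives `‖∑ c_i w̄_i k_i‖² = ‖∑ c_i k_i‖² - |∑ c_i|² + |∑ c_i conj (b w_i)|²`, and only the last term
needs control (in effect, `b` must lie in `H(b)`). This is where `log (1 - |b|) ∈ L¹` enters: it
yields a holomorphic `a` with `a 0 ≠ 0` and `|a|² + |b|² ≤ 1` (`SchurFunction.exists_companion`),
and integrating over the circle gives `|a 0|² |∑ c_i conj (b w_i)|² ≤ ‖∑ c_i k_i‖²`
(`normSq_sum_le_kernel_sum_re`).

For the spans, `k_μ f = ∑ μ̄ⁿ Sⁿ f` when `|μ| ‖S‖ < 1`, which gives one inclusion. Conversely,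
pairing this series with a vector orthogonal to all such `k_μ f` gives a power series vanishing near
`0`; its coefficients vanish, so every `Sⁿ f` lies in the closed span of the `k_μ f`. -/

namespace DeBrangesRovnyak

/-! ### Poisson integrals and the companion function -/

/-- A non-constant Schur function has modulus strictly less than `1` on the disc. -/
theorem SchurFunction.Nonconstant.norm_lt_one {b : SchurFunction} (hb : b.Nonconstant) {z : ℂ}
    (hz : z ∈ ball (0 : ℂ) 1) : ‖b z‖ < 1 := by
  refine lt_of_le_of_ne (b.norm_le_one z hz) fun h => ?_
  have hmax : IsMaxOn (norm ∘ b.toFun) (ball 0 1) z := fun w hw => by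
    simpa [h] using b.norm_le_one w hw
  have hconst := Complex.eqOn_of_isPreconnected_of_isMaxOn_norm
    (convex_ball (0 : ℂ) 1).isPreconnected isOpen_ball b.differentiableOn hz hmax
  obtain ⟨x, y, hxy⟩ := hb
  have hmem : ∀ x : UnitDisc, (x : ℂ) ∈ ball (0 : ℂ) 1 := fun x => by simpa using x.norm_lt_one
  exact hxy ((hconst (hmem x)).trans (hconst (hmem y)).symm)

theorem re_herglotzRieszKernel_nonneg {w ζ : ℂ} (hw : w ∈ ball (0 : ℂ) 1)
    (hζ : ζ ∈ sphere (0 : ℂ) 1) : 0 ≤ (herglotzRieszKernel 0 w ζ).re := by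
  refine le_trans ?_ (le_re_herglotzRieszKernel hζ hw)
  have : ‖w‖ < 1 := by simpa using hw
  rw [sub_zero]
  exact div_nonneg (by linarith) (by positivity)

theorem continuousOn_re_herglotzRieszKernel {w : ℂ} (hw : w ∈ ball (0 : ℂ) 1) :
    ContinuousOn (fun ζ => (herglotzRieszKernel 0 w ζ).re) (sphere 0 |1|) :=
  Complex.continuous_re.comp_continuousOn (continuousOn_herglotzRieszKernel_sphere hw)

theorem circleAverage_re_herglotzRieszKernel {w : ℂ} (hw : w ∈ ball (0 : ℂ) 1) :
    Real.circleAverage (fun ζ => (herglotzRieszKernel 0 w ζ).re) 0 1 = 1 := by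
  have h := DiffContOnCl.circleAverage_re_herglotzRieszKernel_smul (f := fun _ => (1 : ℂ))
    (R := 1) (c := 0) (diffContOnCl_const) hw
  have hi : CircleIntegrable (fun ζ => ((herglotzRieszKernel 0 w ζ).re : ℂ)) 0 1 :=
    (Complex.continuous_ofReal.comp_continuousOn
      (continuousOn_re_herglotzRieszKernel hw)).circleIntegrable'
  have h2 := ContinuousLinearMap.circleAverage_comp_comm Complex.reCLM hi
  have h3 : Real.circleAverage (fun ζ => ((herglotzRieszKernel 0 w ζ).re : ℂ)) 0 1 = 1 := by
    rw [← h]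
    congr 1
    ext ζ
    simp
  rw [h3] at h2
  simpa [Function.comp_def] using h2

/-- The Poisson integral of a bounded radial limit of `|b|` dominates `|b|` on the disc. -/
theorem SchurFunction.norm_le_circleAverage (b : SchurFunction) {β : ℂ → ℂ}
    (hβ : ∀ᵐ θ : ℝ, Tendsto (fun r : ℝ => b (circleMap 0 r θ)) (𝓝[<] 1)
      (𝓝 (β (circleMap 0 1 θ)))) {w : ℂ} (hw : w ∈ ball (0 : ℂ) 1) :
    CircleIntegrable (fun ζ => ‖β ζ‖) 0 1 ∧
    ‖b w‖ ≤ Real.circleAverage (fun ζ => (herglotzRieszKernel 0 w ζ).re * ‖β ζ‖) 0 1 := by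
  have hP := continuousOn_re_herglotzRieszKernel hw
  have hcirc : ∀ (r θ : ℝ), (r : ℂ) * circleMap 0 1 θ = circleMap 0 r θ := fun r θ => by
    simp [circleMap]
  have hmem : ∀ r ∈ Set.Ioo (0 : ℝ) 1, ∀ z ∈ closedBall (0 : ℂ) 1, (r : ℂ) * z ∈ ball (0 : ℂ) 1 := by
    intro r hr z hz
    have hz' : ‖z‖ ≤ 1 := by simpa using hz
    have : ‖(r : ℂ) * z‖ < 1 := by
      rw [norm_mul, Complex.norm_real, Real.norm_of_nonneg hr.1.le]
      nlinarith [hr.1, hr.2, norm_nonneg z]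
    simpa using this
  have hev : ∀ᶠ r : ℝ in 𝓝[<] 1, r ∈ Set.Ioo (0 : ℝ) 1 := Ioo_mem_nhdsLT zero_lt_one
  have hbr : ∀ r ∈ Set.Ioo (0 : ℝ) 1,
      DifferentiableOn ℂ (fun z => b (r * z)) (closedBall 0 1) := fun r hr =>
    b.differentiableOn.comp (by fun_prop) (hmem r hr)
  have hsph : ∀ θ : ℝ, circleMap 0 1 θ ∈ sphere (0 : ℂ) |1| := fun θ => by
    simp
  have hcont : ∀ r ∈ Set.Ioo (0 : ℝ) 1, Continuous fun θ : ℝ => ‖b (circleMap 0 r θ)‖ := by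
    intro r hr
    have := ((hbr r hr).continuousOn.comp_continuous (continuous_circleMap 0 1)
      (fun θ => by simp)).norm
    simpa only [Function.comp_apply, hcirc] using this
  have hPc : Continuous fun θ : ℝ => (herglotzRieszKernel 0 w (circleMap 0 1 θ)).re :=
    hP.comp_continuous (continuous_circleMap 0 1) hsph
  have hP0 : ∀ θ : ℝ, 0 ≤ (herglotzRieszKernel 0 w (circleMap 0 1 θ)).re := fun θ =>
    re_herglotzRieszKernel_nonneg hw (by simp)
  have hle : ∀ r ∈ Set.Ioo (0 : ℝ) 1, ∀ θ : ℝ, ‖b (circleMap 0 r θ)‖ ≤ 1 := fun r hr θ => by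
    rw [← hcirc]
    exact b.norm_le_one _ (hmem r hr _ (by simp))
  have hnorm : ∀ᵐ θ : ℝ, Tendsto (fun r : ℝ => ‖b (circleMap 0 r θ)‖) (𝓝[<] 1)
      (𝓝 ‖β (circleMap 0 1 θ)‖) := hβ.mono fun θ h => h.norm
  constructor
  · have hm : MeasureTheory.AEStronglyMeasurable (fun θ : ℝ => ‖β (circleMap 0 1 θ)‖) := by
      -- Outside `(0, 1)` the circle of radius `r` may leave the disc, where `b` is arbitrary; the
      -- cutoff makes every member of the family measurable.
      refine aestronglyMeasurable_of_tendsto_ae (u := 𝓝[<] (1 : ℝ))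
        (f := fun (r : ℝ) θ => if r ∈ Set.Ioo (0 : ℝ) 1 then ‖b (circleMap 0 r θ)‖ else 0) ?_ ?_
      · intro r
        by_cases hr : r ∈ Set.Ioo (0 : ℝ) 1
        · simpa [hr] using (hcont r hr).aestronglyMeasurable
        · simpa only [hr, if_false] using MeasureTheory.aestronglyMeasurable_const
      · filter_upwards [hnorm] with θ hθ
        refine hθ.congr' ?_
        filter_upwards [hev] with r hr
        rw [if_pos hr]
    have hb1 : ∀ᵐ θ : ℝ, ‖‖β (circleMap 0 1 θ)‖‖ ≤ 1 := by
      filter_upwards [hnorm] with θ hθ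
      rw [norm_norm]
      refine le_of_tendsto hθ ?_
      filter_upwards [hev] with r hr using hle r hr θ
    unfold CircleIntegrable
    rw [intervalIntegrable_iff]
    exact MeasureTheory.Measure.integrableOn_of_bounded (M := 1)
      (by simpa using ENNReal.mul_ne_top ENNReal.ofNat_ne_top ENNReal.ofReal_ne_top) hm
      (MeasureTheory.ae_restrict_of_ae hb1)
  · have hT : Tendsto (fun r : ℝ => ∫ θ in (0 : ℝ)..2 * Real.pi,
        (herglotzRieszKernel 0 w (circleMap 0 1 θ)).re * ‖b (circleMap 0 r θ)‖) (𝓝[<] 1)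
        (𝓝 (∫ θ in (0 : ℝ)..2 * Real.pi,
        (herglotzRieszKernel 0 w (circleMap 0 1 θ)).re * ‖β (circleMap 0 1 θ)‖)) := by
      refine intervalIntegral.tendsto_integral_filter_of_dominated_convergence
        (fun θ => (herglotzRieszKernel 0 w (circleMap 0 1 θ)).re) ?_ ?_
        (hPc.intervalIntegrable _ _) ?_
      · filter_upwards [hev] with r hr using (hPc.mul (hcont r hr)).aestronglyMeasurable
      · filter_upwards [hev] with r hr
        refine Eventually.of_forall fun θ _ => ?_
        rw [norm_mul, norm_norm, Real.norm_of_nonneg (hP0 θ)]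
        exact mul_le_of_le_one_right (hP0 θ) (hle r hr θ)
      · filter_upwards [hnorm] with θ hθ _ using hθ.const_mul _
    have hb' : Tendsto (fun r : ℝ => ‖b (r * w)‖) (𝓝[<] 1) (𝓝 ‖b w‖) := by
      have h1 : ContinuousAt b.toFun ((1 : ℝ) * w) := by
        refine (b.differentiableOn.continuousOn).continuousAt (isOpen_ball.mem_nhds ?_)
        simpa using hw
      have h2 : Tendsto (fun r : ℝ => (r : ℂ) * w) (𝓝[<] 1) (𝓝 ((1 : ℝ) * w)) :=
        (Continuous.tendsto (f := fun r : ℝ => (r : ℂ) * w) (by fun_prop) 1).mono_left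
          nhdsWithin_le_nhds
      simpa [Function.comp_def] using (h1.tendsto.comp h2).norm
    rw [Real.circleAverage_def, smul_eq_mul]
    refine le_of_tendsto_of_tendsto hb' (hT.const_mul _) ?_
    filter_upwards [hev] with r hr
    -- The dilate `z ↦ b (r z)` extends past the circle, so the Poisson formula holds for it; the
    -- two limits above then let `r → 1`.
    have hf : DiffContOnCl ℂ (fun z => b (r * z)) (ball 0 1) :=
      DifferentiableOn.diffContOnCl (by
        rw [closure_ball _ one_ne_zero]
        exact hbr r hr)
    rw [← DiffContOnCl.circleAverage_re_herglotzRieszKernel_smul hf hw,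
      Real.circleAverage_def, norm_smul, Real.norm_of_nonneg (by positivity)]
    refine mul_le_mul_of_nonneg_left ?_ (by positivity)
    refine (intervalIntegral.norm_integral_le_integral_norm (by positivity)).trans (le_of_eq ?_)
    refine intervalIntegral.integral_congr fun θ _ => ?_
    simp [Real.norm_of_nonneg (hP0 θ), ← hcirc r θ]

/-- If `log (1 - |b|)` is integrable on the circle, then `b` has a bounded companion `a` with
`|a|² + |b|² ≤ 1` that does not vanish at the origin. -/
theorem SchurFunction.exists_companion {b : SchurFunction} (hb : b.Nonconstant)
    (hlog : b.LogIntegrable) :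
    ∃ a : ℂ → ℂ, DifferentiableOn ℂ a (ball 0 1) ∧ a 0 ≠ 0 ∧
      ∀ z ∈ ball (0 : ℂ) 1, ‖a z‖ ^ 2 + ‖b z‖ ^ 2 ≤ 1 := by
  obtain ⟨β, hβ, hβ1, hint⟩ := hlog
  set g : ℂ → ℝ := fun ζ => Real.log (1 - ‖β ζ‖) with hg
  have hgC : CircleIntegrable (fun ζ => (g ζ : ℂ)) 0 1 := by
    simp only [CircleIntegrable, intervalIntegrable_iff] at hint ⊢
    exact Complex.ofRealCLM.integrable_comp hint
  -- The outer function whose squared modulus is the exponential of the Poisson integral of `log (1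
  -- - |β|)`; an exponential never vanishes.
  refine ⟨fun z => Complex.exp (2⁻¹ *
    Real.circleAverage (fun ζ => herglotzRieszKernel 0 z ζ • (g ζ : ℂ)) 0 1), ?_,
    Complex.exp_ne_zero _, fun z hz => ?_⟩
  · exact ((differentiableOn_circleAverage_herglotzRieszKernel_smul hgC).const_mul _).cexp
  have hlt := hb.norm_lt_one hz
  set t : ℝ := 1 - ‖b z‖ with ht
  have ht0 : 0 < t := by linarith
  obtain ⟨hβi, hβle⟩ := b.norm_le_circleAverage hβ hz
  have hPc := continuousOn_re_herglotzRieszKernel hz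
  have hPi : CircleIntegrable (fun ζ => (herglotzRieszKernel 0 z ζ).re) 0 1 :=
    hPc.circleIntegrable'
  have hPβ : CircleIntegrable (fun ζ => (herglotzRieszKernel 0 z ζ).re * ‖β ζ‖) 0 1 :=
    hβi.continuousOn_smul hPc
  have hPg : CircleIntegrable (fun ζ => (herglotzRieszKernel 0 z ζ).re * g ζ) 0 1 :=
    hint.continuousOn_smul hPc
  -- Jensen's inequality for the Poisson kernel: integrate the tangent bound `log x ≤ log t + x / t
  -- - 1` at `x = 1 - |β|`, then use that the Poisson integral of `|β|` dominates `|b z|`.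
  have hmain : Real.circleAverage (fun ζ => (herglotzRieszKernel 0 z ζ).re * g ζ) 0 1
      ≤ Real.log t := by
    have hup : CircleIntegrable (fun ζ => (t⁻¹ - 1 + Real.log t) • (herglotzRieszKernel 0 z ζ).re
        - t⁻¹ • ((herglotzRieszKernel 0 z ζ).re * ‖β ζ‖)) 0 1 :=
      (hPi.const_smul).sub (hPβ.const_smul)
    calc _ ≤ Real.circleAverage (fun ζ => (t⁻¹ - 1 + Real.log t) • (herglotzRieszKernel 0 z ζ).re
        - t⁻¹ • ((herglotzRieszKernel 0 z ζ).re * ‖β ζ‖)) 0 1 := by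
          rw [Real.circleAverage_def, Real.circleAverage_def, smul_eq_mul, smul_eq_mul]
          refine mul_le_mul_of_nonneg_left ?_ (by positivity)
          refine intervalIntegral.integral_mono_ae (by positivity) hPg hup ?_
          filter_upwards [hβ1] with θ hθ
          have hP0 := re_herglotzRieszKernel_nonneg hz (ζ := circleMap 0 1 θ) (by simp)
          have hx : 0 < 1 - ‖β (circleMap 0 1 θ)‖ := by linarith
          have h1 := Real.log_le_sub_one_of_pos (div_pos hx ht0)
          rw [Real.log_div hx.ne' ht0.ne'] at h1
          have h2 := mul_le_mul_of_nonneg_left h1 hP0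
          simp only [hg, smul_eq_mul]
          rw [div_eq_mul_inv] at h2
          nlinarith
      _ = (t⁻¹ - 1 + Real.log t) - t⁻¹ *
          Real.circleAverage (fun ζ => (herglotzRieszKernel 0 z ζ).re * ‖β ζ‖) 0 1 := by
          have hsub := Real.circleAverage_sub (hPi.const_smul (a := t⁻¹ - 1 + Real.log t))
            (hPβ.const_smul (a := t⁻¹))
          rw [Real.circleAverage_smul, Real.circleAverage_smul,
            circleAverage_re_herglotzRieszKernel hz] at hsub
          rw [smul_eq_mul, smul_eq_mul, mul_one] at hsub
          exact hsub
      _ ≤ (t⁻¹ - 1 + Real.log t) - t⁻¹ * ‖b z‖ := by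
          gcongr
      _ = Real.log t := by
          have : ‖b z‖ = 1 - t := by rw [ht]; ring
          rw [this]
          field_simp
          ring
  have ha : ‖Complex.exp (2⁻¹ *
      Real.circleAverage (fun ζ => herglotzRieszKernel 0 z ζ • (g ζ : ℂ)) 0 1)‖ ^ 2 ≤ t := by
    rw [Complex.norm_exp, ← Real.exp_nat_mul]
    have hre : (2⁻¹ * Real.circleAverage (fun ζ => herglotzRieszKernel 0 z ζ • (g ζ : ℂ)) 0 1).re
        = 2⁻¹ * Real.circleAverage (fun ζ => (herglotzRieszKernel 0 z ζ).re * g ζ) 0 1 := by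
      have h := re_circleAverage_herglotzRieszKernel_smul hint hz
      have h' : ((2 : ℂ)⁻¹) = ((2⁻¹ : ℝ) : ℂ) := by norm_num
      rw [h', Complex.re_ofReal_mul, h]
      rfl
    rw [hre, ← Real.exp_log ht0]
    gcongr
    push_cast
    linarith
  -- Since `|b z| ≤ 1`, `|a|² + |b|² ≤ (1 - |b|) + |b| = 1`.
  have := norm_nonneg (b z)
  nlinarith

/-! ### Quantitative positivity of the kernel -/

/-- A strengthening of the positivity of the kernel for a pair `(A, B)` of functions on the closed
disc with `|A|² + |B|² ≤ 1`. -/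
theorem normSq_sum_le_kernel_sum_re_aux (s : Finset UnitDisc) (c : UnitDisc → ℂ) {A B : ℂ → ℂ}
    (hA : DifferentiableOn ℂ A (closedBall 0 1)) (hB : DifferentiableOn ℂ B (closedBall 0 1))
    (hAB : ∀ z ∈ closedBall (0 : ℂ) 1, ‖A z‖ ^ 2 + ‖B z‖ ^ 2 ≤ 1) :
    normSq (A 0 * ∑ i ∈ s, c i * conj (B i)) ≤ (∑ i ∈ s, ∑ j ∈ s,
      conj ((1 - conj (B i) * B j) / (1 - conj (i : ℂ) * j) * c i) * c j).re := by
  have hk := differentiableOn_cauchyKernel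
  set h : ℂ → ℂ := fun ζ => ∑ i ∈ s, c i * cauchyKernel i ζ with hh
  set g : ℂ → ℂ := fun ζ => ∑ i ∈ s, c i * conj (B i) * cauchyKernel i ζ with hg
  set κ : ℂ := A 0 * ∑ i ∈ s, c i * conj (B i) with hκ
  have hg0 : A 0 * g 0 = κ := by simp [hg, hκ, cauchyKernel]
  have hhD : DifferentiableOn ℂ h (closedBall 0 1) := by fun_prop
  have hgD : DifferentiableOn ℂ g (closedBall 0 1) := by fun_prop
  -- Each `F j` is holomorphic, so the Cauchy kernel reproduces it; the `F j j` sum to the conjugate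
  -- of the kernel form.
  set F : UnitDisc → ℂ → ℂ := fun j ζ =>
    conj (c j) * h ζ + conj (c j) * B j * g ζ - 2 * conj (c j) * (B ζ * g ζ) with hF
  have hFD : ∀ j, DifferentiableOn ℂ (F j) (closedBall 0 1) := fun j => by fun_prop
  set I : ℂ → ℂ := fun ζ =>
    h ζ * conj (h ζ) + g ζ * conj (g ζ) - 2 * (B ζ * g ζ) * conj (h ζ) with hI
  have hpt : ∀ ζ, ∑ j ∈ s, F j ζ * conj (cauchyKernel j ζ) = I ζ := by
    intro ζ
    have e1 : conj (h ζ) = ∑ j ∈ s, conj (c j) * conj (cauchyKernel j ζ) := by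
      simp [hh]
    have e2 : conj (g ζ) = ∑ j ∈ s, conj (c j) * B j * conj (cauchyKernel j ζ) := by
      simp [hg]
    simp only [hI]
    rw [e1, e2, Finset.mul_sum, Finset.mul_sum, Finset.mul_sum, ← Finset.sum_add_distrib,
      ← Finset.sum_sub_distrib]
    refine Finset.sum_congr rfl fun j _ => ?_
    simp only [hF]
    ring
  have hci : ∀ j, CircleIntegrable (fun ζ => F j ζ * conj (cauchyKernel j ζ)) 0 1 := fun j => by
    refine ContinuousOn.circleIntegrable zero_le_one ?_
    have h1 := ((hFD j).continuousOn).mono sphere_subset_closedBall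
    have h2 := ((hk j).continuousOn).mono sphere_subset_closedBall
    exact h1.mul (Complex.continuous_conj.comp_continuousOn h2)
  have hIi : CircleIntegrable I 0 1 := by
    rw [← funext hpt]
    exact CircleIntegrable.fun_sum _ (fun j _ => hci j)
  have hIav : Real.circleAverage I 0 1 = ∑ j ∈ s, F j j := by
    rw [← funext hpt, Real.circleAverage_fun_sum (fun j _ => hci j)]
    exact Finset.sum_congr rfl fun j _ => circleAverage_mul_conj_cauchyKernel (hFD j) j
  -- The real part of `J` is the linear minorant `2 Re (κ̄ x) - |κ|²` of `|x|²` at `x = A g`. Being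
  -- holomorphic, `J` averages to `J 0 = |κ|²`.
  set J : ℂ → ℂ := fun ζ => 2 * conj κ * (A ζ * g ζ) - κ * conj κ with hJ
  have hJD : DifferentiableOn ℂ J (closedBall 0 1) := by fun_prop
  have hJi : CircleIntegrable J 0 1 :=
    ContinuousOn.circleIntegrable zero_le_one (hJD.continuousOn.mono sphere_subset_closedBall)
  have hJav : Real.circleAverage J 0 1 = κ * conj κ := by
    have h0 := circleAverage_mul_conj_cauchyKernel hJD 0
    simp only [cauchyKernel, UnitDisc.coe_zero, map_zero, zero_mul, sub_zero, div_one, map_one,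
      mul_one] at h0
    rw [h0, hJ]
    simp only
    rw [hg0]
    ring
  have hre : 0 ≤ (∑ j ∈ s, F j j - κ * conj κ).re := by
    rw [← hIav, ← hJav, ← Real.circleAverage_sub hIi hJi]
    have h3 : (Real.circleAverage (I - J) 0 1).re = Real.circleAverage (Complex.reCLM ∘ (I - J)) 0 1 :=
      (ContinuousLinearMap.circleAverage_comp_comm Complex.reCLM (hIi.sub hJi)).symm
    rw [h3]
    refine Real.circleAverage_nonneg_of_nonneg fun ζ hζ => ?_
    have hABζ := hAB ζ (sphere_subset_closedBall (by simpa using hζ))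
    have key : (I ζ).re = normSq (g ζ - conj (B ζ) * h ζ) + (1 - normSq (B ζ)) * normSq (h ζ) := by
      simp only [hI, Complex.normSq_apply, Complex.add_re, Complex.sub_re, Complex.mul_re,
        Complex.mul_im, Complex.conj_re, Complex.conj_im, Complex.re_ofNat, Complex.im_ofNat,
        Complex.sub_im]
      ring
    have keyJ : (J ζ).re = normSq (A ζ * g ζ) - normSq (A ζ * g ζ - κ) := by
      simp only [hJ, Complex.normSq_apply, Complex.sub_re, Complex.mul_re,
        Complex.mul_im, Complex.conj_re, Complex.conj_im, Complex.re_ofNat, Complex.im_ofNat,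
        Complex.sub_im]
      ring
    have hAg : normSq (A ζ * g ζ) ≤ (I ζ).re := by
      set u := g ζ - conj (B ζ) * h ζ with hu
      have hgu : g ζ = u + conj (B ζ) * h ζ := by rw [hu]; ring
      have h1 : ‖g ζ‖ ≤ ‖u‖ + ‖B ζ‖ * ‖h ζ‖ := by
        rw [hgu]
        refine (norm_add_le _ _).trans (le_of_eq ?_)
        rw [norm_mul, RCLike.norm_conj]
      have h2 : ‖A ζ‖ * ‖g ζ‖ ≤ ‖A ζ‖ * (‖u‖ + ‖B ζ‖ * ‖h ζ‖) :=
        mul_le_mul_of_nonneg_left h1 (norm_nonneg _)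
      have h3 : (‖A ζ‖ * ‖g ζ‖) ^ 2 ≤ (‖A ζ‖ * (‖u‖ + ‖B ζ‖ * ‖h ζ‖)) ^ 2 :=
        pow_le_pow_left₀ (by positivity) h2 2
      -- Cauchy–Schwarz for the vectors `(|A|, |B|)` and `(|u|, |A h|)`; afterwards `|A h|² ≤ (1 -
      -- |B|²) |h|²`.
      have h4 : (‖A ζ‖ * (‖u‖ + ‖B ζ‖ * ‖h ζ‖)) ^ 2
          ≤ (‖A ζ‖ ^ 2 + ‖B ζ‖ ^ 2) * (‖u‖ ^ 2 + (‖A ζ‖ * ‖h ζ‖) ^ 2) := by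
        nlinarith [sq_nonneg (‖A ζ‖ * (‖A ζ‖ * ‖h ζ‖) - ‖B ζ‖ * ‖u‖)]
      have h5 : (‖A ζ‖ ^ 2 + ‖B ζ‖ ^ 2) * (‖u‖ ^ 2 + (‖A ζ‖ * ‖h ζ‖) ^ 2)
          ≤ ‖u‖ ^ 2 + (‖A ζ‖ * ‖h ζ‖) ^ 2 := mul_le_of_le_one_left (by positivity) hABζ
      rw [key]
      simp only [Complex.normSq_eq_norm_sq, norm_mul]
      nlinarith [mul_le_mul_of_nonneg_right hABζ (sq_nonneg ‖h ζ‖)]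
    change 0 ≤ (I ζ - J ζ).re
    rw [Complex.sub_re, keyJ]
    linarith [normSq_nonneg (A ζ * g ζ - κ)]
  have hfin : (∑ i ∈ s, ∑ j ∈ s,
      conj ((1 - conj (B i) * B j) / (1 - conj (i : ℂ) * j) * c i) * c j)
      = conj (∑ j ∈ s, F j j) := by
    rw [Finset.sum_comm, map_sum]
    refine Finset.sum_congr rfl fun j _ => ?_
    simp only [hF, hh, hg, cauchyKernel]
    rw [← Complex.conj_conj (∑ i ∈ s, _)]
    congr 1
    simp only [Finset.mul_sum, ← Finset.sum_add_distrib, ← Finset.sum_sub_distrib, map_sum]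
    refine Finset.sum_congr rfl fun i _ => ?_
    simp only [map_mul, Complex.conj_conj]
    ring
  rw [hfin, Complex.conj_re]
  rw [Complex.sub_re, Complex.mul_conj, Complex.ofReal_re] at hre
  linarith

/-- Dilating `a` and `b` by `r < 1` reduces to functions holomorphic on the closed disc and leaves
`a 0` unchanged; then `r → 1`. -/
theorem normSq_sum_le_kernel_sum_re (b : SchurFunction) {a : ℂ → ℂ}
    (ha : DifferentiableOn ℂ a (ball 0 1)) (hab : ∀ z ∈ ball (0 : ℂ) 1, ‖a z‖ ^ 2 + ‖b z‖ ^ 2 ≤ 1)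
    (s : Finset UnitDisc) (c : UnitDisc → ℂ) :
    normSq (a 0 * ∑ i ∈ s, c i * conj (b i)) ≤ (∑ i ∈ s, ∑ j ∈ s,
      conj ((1 - conj (b i) * b j) / (1 - conj (i : ℂ) * j) * c i) * c j).re := by
  have hlim : ∀ x : UnitDisc, Tendsto (fun r : ℝ => b (r * x)) (𝓝[<] 1) (𝓝 (b x)) := by
    intro x
    have h1 : ContinuousAt b.toFun ((1 : ℝ) * (x : ℂ)) := by
      refine (b.differentiableOn.continuousOn).continuousAt (isOpen_ball.mem_nhds ?_)
      simpa using x.norm_lt_one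
    have h2 : Tendsto (fun r : ℝ => (r : ℂ) * (x : ℂ)) (𝓝[<] 1) (𝓝 ((1 : ℝ) * (x : ℂ))) :=
      (Continuous.tendsto (f := fun r : ℝ => (r : ℂ) * (x : ℂ)) (by fun_prop) 1).mono_left
        nhdsWithin_le_nhds
    simpa [Function.comp_def] using h1.tendsto.comp h2
  have hT : Tendsto (fun r : ℝ => (∑ i ∈ s, ∑ j ∈ s,
      conj ((1 - conj (b (r * i)) * b (r * j)) / (1 - conj (i : ℂ) * j) * c i) * c j).re)
      (𝓝[<] 1) (𝓝 (∑ i ∈ s, ∑ j ∈ s,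
      conj ((1 - conj (b i) * b j) / (1 - conj (i : ℂ) * j) * c i) * c j).re) := by
    refine (Complex.continuous_re.tendsto _).comp ?_
    refine tendsto_finsetSum _ fun i _ => tendsto_finsetSum _ fun j _ => ?_
    refine Tendsto.mul_const _ ((Complex.continuous_conj.tendsto _).comp ?_)
    refine Tendsto.mul_const _ (Tendsto.div_const (Tendsto.const_sub _ ?_) _)
    exact ((Complex.continuous_conj.tendsto _).comp (hlim i)).mul (hlim j)
  have hT' : Tendsto (fun r : ℝ => normSq (a 0 * ∑ i ∈ s, c i * conj (b (r * i)))) (𝓝[<] 1)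
      (𝓝 (normSq (a 0 * ∑ i ∈ s, c i * conj (b i)))) := by
    refine (Complex.continuous_normSq.tendsto _).comp (Tendsto.const_mul _ ?_)
    exact tendsto_finsetSum _ fun i _ =>
      ((Complex.continuous_conj.tendsto _).comp (hlim i)).const_mul _
  refine le_of_tendsto_of_tendsto hT' hT ?_
  have hev : ∀ᶠ r : ℝ in 𝓝[<] 1, r ∈ Set.Ioo (0 : ℝ) 1 := Ioo_mem_nhdsLT zero_lt_one
  filter_upwards [hev] with r hr
  have hmem : ∀ z ∈ closedBall (0 : ℂ) 1, (r : ℂ) * z ∈ ball (0 : ℂ) 1 := by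
    intro z hz
    have hz' : ‖z‖ ≤ 1 := by simpa using hz
    have : ‖(r : ℂ) * z‖ < 1 := by
      rw [norm_mul, Complex.norm_real, Real.norm_of_nonneg hr.1.le]
      nlinarith [hr.1, hr.2, norm_nonneg z]
    simpa using this
  have := normSq_sum_le_kernel_sum_re_aux s c (A := fun z => a (r * z)) (B := fun z => b (r * z))
    (ha.comp (by fun_prop) hmem) (b.differentiableOn.comp (by fun_prop) hmem)
    fun z hz => hab _ (hmem z hz)
  simpa only [mul_zero] using this

/-! ### Kernel functions and boundedness of the shift -/

/-- The reproducing kernel function `k_w^b`. -/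
noncomputable def kernelFun (b : SchurFunction) (w : UnitDisc) : DBRSpace b :=
  RKHS.kerFun (DBRSpace b) w 1

theorem inner_kernelFun {b : SchurFunction} (w : UnitDisc) (f : DBRSpace b) :
    inner ℂ (kernelFun b w) f = f w := by
  simp [kernelFun]

theorem kernelFun_apply (b : SchurFunction) (w z : UnitDisc) :
    kernelFun b w z = (1 - conj (b w) * b z) / (1 - conj (w : ℂ) * z) := by
  simp [kernelFun, RKHS.kerFun_apply, kernel_DBRSpace, kernel]

theorem denseRange_linearCombination_kernelFun (b : SchurFunction) :
    DenseRange (Finsupp.linearCombination ℂ (kernelFun b)) := by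
  have h := RKHS.kerFun_dense (DBRSpace b)
  have hle : Submodule.span ℂ {RKHS.kerFun (DBRSpace b) x v | (x) (v)}
      ≤ LinearMap.range (Finsupp.linearCombination ℂ (kernelFun b)) := by
    rw [Submodule.span_le]
    rintro _ ⟨x, v, rfl⟩
    refine ⟨Finsupp.single x v, ?_⟩
    rw [Finsupp.linearCombination_single, kernelFun, ← map_smul, smul_eq_mul, mul_one]
  intro y
  have hy : y ∈ (Submodule.span ℂ {RKHS.kerFun (DBRSpace b) x v | (x) (v)}).topologicalClosure := by
    rw [h]; trivial
  exact closure_mono hle hy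

theorem norm_sq_sum_kernelFun (b : SchurFunction) (s : Finset UnitDisc) (c : UnitDisc → ℂ) :
    ‖∑ i ∈ s, c i • kernelFun b i‖ ^ 2 = (∑ i ∈ s, ∑ j ∈ s,
      conj ((1 - conj (b i) * b j) / (1 - conj (i : ℂ) * j) * c i) * c j).re := by
  rw [← inner_self_eq_norm_sq (𝕜 := ℂ)]
  change Complex.re _ = _
  rw [sum_inner]
  congr 1
  refine Finset.sum_congr rfl fun i _ => ?_
  rw [inner_sum]
  refine Finset.sum_congr rfl fun j _ => ?_
  rw [inner_smul_left, inner_smul_right, ← inner_conj_symm, inner_kernelFun, kernelFun_apply,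
    map_mul]
  ring

/-- Multiplying a kernel entry by `w̄ z` subtracts `1 - conj (b w) b z`, since the denominator is `1
- w̄ z`; the correction is a difference of two rank-one forms. -/
theorem norm_sq_sum_conj_smul_kernelFun (b : SchurFunction) (s : Finset UnitDisc)
    (c : UnitDisc → ℂ) :
    ‖∑ i ∈ s, (c i * conj (i : ℂ)) • kernelFun b i‖ ^ 2 =
      ‖∑ i ∈ s, c i • kernelFun b i‖ ^ 2 - normSq (∑ i ∈ s, c i)
        + normSq (∑ i ∈ s, c i * conj (b i)) := by
  rw [norm_sq_sum_kernelFun, norm_sq_sum_kernelFun]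
  have h1 : normSq (∑ i ∈ s, c i) = (∑ i ∈ s, ∑ j ∈ s, conj (c i) * c j).re := by
    rw [← Finset.sum_mul_sum, ← map_sum, mul_comm, Complex.mul_conj, Complex.ofReal_re]
  have h2 : normSq (∑ i ∈ s, c i * conj (b i))
      = (∑ i ∈ s, ∑ j ∈ s, conj (c i * conj (b i)) * (c j * conj (b j))).re := by
    rw [← Finset.sum_mul_sum, ← map_sum, mul_comm, Complex.mul_conj, Complex.ofReal_re]
  rw [h1, h2, ← Complex.sub_re, ← Complex.add_re, ← Finset.sum_sub_distrib,
    ← Finset.sum_add_distrib]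
  congr 1
  refine Finset.sum_congr rfl fun i _ => ?_
  rw [← Finset.sum_sub_distrib, ← Finset.sum_add_distrib]
  refine Finset.sum_congr rfl fun j _ => ?_
  have hne : 1 - (i : ℂ) * conj (j : ℂ) ≠ 0 := by
    have := one_sub_conj_mul_ne_zero j (z := i) i.norm_lt_one.le
    rwa [mul_comm]
  simp only [map_mul, map_div₀, map_sub, map_one, Complex.conj_conj]
  field_simp
  ring

/-- The shift operator acts boundedly on `H(b)` when `log (1 - |b|)` is integrable. -/
theorem exists_isShift {b : SchurFunction} (hb : b.Nonconstant) (hlog : b.LogIntegrable) :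
    ∃ S : DBRSpace b →L[ℂ] DBRSpace b, IsShift S := by
  obtain ⟨a, ha, ha0, hab⟩ := SchurFunction.exists_companion hb hlog
  set e := Finsupp.linearCombination ℂ (kernelFun b) with he
  set t := Finsupp.linearCombination ℂ (fun w : UnitDisc => conj (w : ℂ) • kernelFun b w) with ht
  have hbound : ∃ C : ℝ, ∀ c, ‖t c‖ ≤ C * ‖e c‖ := by
    -- Drop `-|∑ c_i|²` and bound the remaining extra term by `‖e c‖² / |a 0|²`.
    refine ⟨√(1 + (normSq (a 0))⁻¹), fun c => ?_⟩
    have h0 : 0 < normSq (a 0) := Complex.normSq_pos.2 ha0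
    have hec : e c = ∑ i ∈ c.support, c i • kernelFun b i := rfl
    have htc : t c = ∑ i ∈ c.support, (c i * conj (i : ℂ)) • kernelFun b i := by
      rw [ht, Finsupp.linearCombination_apply, Finsupp.sum]
      exact Finset.sum_congr rfl fun i _ => smul_smul _ _ _
    have h1 := normSq_sum_le_kernel_sum_re b ha hab c.support c
    rw [← norm_sq_sum_kernelFun, ← hec, Complex.normSq_mul] at h1
    have h2 := norm_sq_sum_conj_smul_kernelFun b c.support c
    rw [← htc, ← hec] at h2
    have h3 : normSq (∑ i ∈ c.support, c i * conj (b i)) ≤ (normSq (a 0))⁻¹ * ‖e c‖ ^ 2 := by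
      rwa [inv_mul_eq_div, le_div_iff₀' h0]
    refine le_of_sq_le_sq ?_ (by positivity)
    rw [mul_pow, Real.sq_sqrt (by positivity)]
    nlinarith [normSq_nonneg (∑ i ∈ c.support, c i)]
  refine ⟨ContinuousLinearMap.adjoint (t.extendOfNorm e), fun f z => ?_⟩
  have hk : t.extendOfNorm e (kernelFun b z) = conj (z : ℂ) • kernelFun b z := by
    have := LinearMap.extendOfNorm_eq (denseRange_linearCombination_kernelFun b) hbound
      (Finsupp.single z 1)
    simpa [he, ht] using this
  rw [← inner_kernelFun, ContinuousLinearMap.adjoint_inner_right, hk, inner_smul_left,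
    inner_kernelFun, Complex.conj_conj]

/-! ### Orbits, resolvents and closed spans -/

theorem IsShift.pow_apply {b : SchurFunction} {S : DBRSpace b →L[ℂ] DBRSpace b} (hS : IsShift S)
    (f : DBRSpace b) (n : ℕ) (z : UnitDisc) : (S ^ n) f z = (z : ℂ) ^ n * f z := by
  induction n with
  | zero => simp
  | succ n ih =>
    rw [pow_succ', mul_apply_eq_comp, hS, ih]
    ring

/-- Needed because `1 / ‖S‖` would be `0` in Lean for `S = 0`, leaving no admissible `μ`. At `w =
1/2` both `w` and `k_w^b(w)` are nonzero, so `S` does not kill `k_w^b`. -/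
theorem IsShift.norm_pos {b : SchurFunction} (hb : b.Nonconstant)
    {S : DBRSpace b →L[ℂ] DBRSpace b} (hS : IsShift S) : 0 < ‖S‖ := by
  rw [norm_pos_iff]
  rintro rfl
  obtain ⟨w, hw⟩ : ∃ w : UnitDisc, (w : ℂ) = 1 / 2 := ⟨UnitDisc.mk (1 / 2) (by norm_num), rfl⟩
  have h := hS (kernelFun b w) w
  have hlt := hb.norm_lt_one (z := w) (by simpa using w.norm_lt_one)
  rw [kernelFun_apply] at h
  have h1 : 1 - conj (b w) * b w ≠ 0 := by
    intro h0
    have h2 : ‖conj (b w) * b w‖ = 1 := by rw [← sub_eq_zero.1 h0]; simp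
    rw [norm_mul, RCLike.norm_conj] at h2
    nlinarith [norm_nonneg (b w)]
  have h2 := one_sub_conj_mul_ne_zero w (z := w) w.norm_lt_one.le
  have h3 : (w : ℂ) ≠ 0 := by rw [hw]; norm_num
  simp [h1, h2, h3] at h

/-- The resolvent series of the shift represents multiplication by a Cauchy kernel. -/
theorem IsShift.exists_hasSum {b : SchurFunction} {S : DBRSpace b →L[ℂ] DBRSpace b}
    (hS : IsShift S) (f : DBRSpace b) {μ : UnitDisc} (hμ : ‖(μ : ℂ)‖ * ‖S‖ < 1) :
    ∃ g : DBRSpace b, IsMul (cauchyKernel μ) f g ∧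
      HasSum (fun n : ℕ => conj (μ : ℂ) ^ n • (S ^ n) f) g := by
  have hT : ‖conj (μ : ℂ) • S‖ < 1 := by rwa [norm_smul, RCLike.norm_conj]
  set R := ∑' n : ℕ, (conj (μ : ℂ) • S) ^ n with hR
  have hsum : HasSum (fun n : ℕ => conj (μ : ℂ) ^ n • (S ^ n) f) (R f) := by
    have := (ContinuousLinearMap.apply ℂ (DBRSpace b) f).hasSum
      (summable_geometric_of_norm_lt_one hT).hasSum
    simpa [Function.comp_def, smul_pow, hR] using this
  refine ⟨R f, fun z => ?_, hsum⟩
  -- Evaluating `(1 - μ̄ S) R = 1` at `f` and `z` gives `(1 - μ̄ z) (R f)(z) = f z`.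
  have h1 := congrArg (fun U : DBRSpace b →L[ℂ] DBRSpace b => U f z)
    (mul_neg_geom_series (conj (μ : ℂ) • S) hT)
  have h2 : R f z - conj (μ : ℂ) * ((z : ℂ) * R f z) = f z := by
    rw [← hS]
    simpa [← hR] using h1
  have hne := one_sub_conj_mul_ne_zero μ (z := z) z.norm_lt_one.le
  rw [cauchyKernel, ← h2]
  field_simp

theorem setOf_isMul_pow {b : SchurFunction} {S : DBRSpace b →L[ℂ] DBRSpace b} (hS : IsShift S)
    (f : DBRSpace b) :
    {g : DBRSpace b | ∃ n : ℕ, IsMul (fun z => z ^ n) f g} = Set.range fun n : ℕ => (S ^ n) f := by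
  ext g
  refine exists_congr fun n => ⟨fun h => RKHS.ext fun z => ?_, ?_⟩
  · rw [hS.pow_apply, h z]
  · rintro rfl z
    exact hS.pow_apply f n z

/-- If a power series with vector coefficients takes its values near the origin in a closed
subspace, then its coefficients lie in that subspace. -/
theorem mem_of_eventually_hasSum_mem {E : Type*} [NormedAddCommGroup E] [InnerProductSpace ℂ E]
    [CompleteSpace E] {K : Submodule ℂ E} (hK : IsClosed (K : Set E)) {v : ℕ → E}
    (h : ∀ᶠ z : ℂ in 𝓝 0, ∃ g ∈ K, HasSum (fun n => z ^ n • v n) g) (n : ℕ) : v n ∈ K := by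
  have : CompleteSpace K := hK.completeSpace_coe
  rw [← Submodule.orthogonal_orthogonal K]
  refine (Submodule.mem_orthogonal _ _).2 fun x hx => ?_
  set p : FormalMultilinearSeries ℂ ℂ ℂ := fun n =>
    ContinuousMultilinearMap.mkPiRing ℂ (Fin n) (inner ℂ x (v n)) with hp
  have hcoeff : ∀ n, p.coeff n = inner ℂ x (v n) := fun n => by
    simp [hp, FormalMultilinearSeries.coeff]
  have hser : HasFPowerSeriesAt (0 : ℂ → ℂ) p 0 := by
    rw [hasFPowerSeriesAt_iff]
    filter_upwards [h] with z ⟨g, hg, hs⟩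
    have h1 := (innerSL ℂ x).hasSum hs
    have h2 : inner ℂ x g = 0 := (Submodule.mem_orthogonal' _ _).1 hx g hg
    simpa [Function.comp_def, hcoeff, h2] using h1
  rw [← hcoeff, hser.eq_zero]
  rfl

theorem IsShift.closedSpan_eq {b : SchurFunction} (hb : b.Nonconstant)
    {S : DBRSpace b →L[ℂ] DBRSpace b} (hS : IsShift S) (f : DBRSpace b) :
    closedSpan (Set.range fun n : ℕ => (S ^ n) f) =
      closedSpan {g : DBRSpace b | ∃ μ : UnitDisc, ‖(μ : ℂ)‖ < 1 / ‖S‖ ∧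
        IsMul (cauchyKernel μ) f g} := by
  have hpos := hS.norm_pos hb
  apply le_antisymm
  · refine Submodule.topologicalClosure_minimal _ (Submodule.span_le.2 ?_)
      (Submodule.isClosed_topologicalClosure _)
    rintro _ ⟨n, rfl⟩
    refine mem_of_eventually_hasSum_mem (Submodule.isClosed_topologicalClosure _)
      (v := fun n => (S ^ n) f) ?_ n
    filter_upwards [ball_mem_nhds (0 : ℂ) one_pos,
      ball_mem_nhds (0 : ℂ) (one_div_pos.2 hpos)] with z hz1 hz2
    rw [mem_ball_zero_iff] at hz1 hz2
    -- `k_μ` is antiholomorphic in `μ`; taking `μ = z̄` makes the resolvent series a power series in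
    -- `z`.
    set μ : UnitDisc := UnitDisc.mk (conj z) (by rwa [RCLike.norm_conj]) with hμ
    have hμz : (μ : ℂ) = conj z := rfl
    have hμS : ‖(μ : ℂ)‖ < 1 / ‖S‖ := by rwa [hμz, RCLike.norm_conj]
    obtain ⟨g, hg, hs⟩ := hS.exists_hasSum f ((lt_div_iff₀ hpos).1 hμS)
    refine ⟨g, Submodule.le_topologicalClosure _ (Submodule.subset_span ⟨μ, hμS, hg⟩), ?_⟩
    simpa [hμz] using hs
  · refine Submodule.topologicalClosure_minimal _ (Submodule.span_le.2 ?_)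
      (Submodule.isClosed_topologicalClosure _)
    rintro g ⟨μ, hμ, hg⟩
    obtain ⟨g', hg', hs⟩ := hS.exists_hasSum f ((lt_div_iff₀ hpos).1 hμ)
    obtain rfl : g = g' := RKHS.ext fun z => (hg z).trans (hg' z).symm
    refine (Submodule.isClosed_topologicalClosure _).mem_of_tendsto hs
      (Eventually.of_forall fun s => Submodule.sum_mem _ fun n _ => Submodule.smul_mem _ _ ?_)
    exact Submodule.le_topologicalClosure _ (Submodule.subset_span ⟨n, rfl⟩)

end DeBrangesRovnyak

theorem mainTheorem6 (b : SchurFunction) (hb : b.Nonconstant) (hlog : b.LogIntegrable) :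
    (∃! S : DBRSpace b →L[ℂ] DBRSpace b, IsShift S) ∧
    ∀ S : DBRSpace b →L[ℂ] DBRSpace b, IsShift S → ∀ f : DBRSpace b,
      (∀ μ : UnitDisc, ‖(μ : ℂ)‖ < 1 / ‖S‖ → ∃ g : DBRSpace b, IsMul (cauchyKernel μ) f g) ∧
      closedSpan {g : DBRSpace b | ∃ n : ℕ, IsMul (fun z => z ^ n) f g} =
        closedSpan {g : DBRSpace b | ∃ μ : UnitDisc, ‖(μ : ℂ)‖ < 1 / ‖S‖ ∧
          IsMul (cauchyKernel μ) f g} ∧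
      (IsCyclicVector S f ↔
        closedSpan {g : DBRSpace b | ∃ μ : UnitDisc, ‖(μ : ℂ)‖ < 1 / ‖S‖ ∧
          IsMul (cauchyKernel μ) f g} = ⊤) := by
  refine ⟨?_, fun S hS f => ⟨fun μ hμ => ?_, ?_, ?_⟩⟩
  · obtain ⟨S, hS⟩ := exists_isShift hb hlog
    refine ⟨S, hS, fun T hT => ContinuousLinearMap.ext fun f => RKHS.ext fun z => ?_⟩
    rw [hT, hS]
  · obtain ⟨g, hg, -⟩ := hS.exists_hasSum f ((lt_div_iff₀ (hS.norm_pos hb)).1 hμ)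
    exact ⟨g, hg⟩
  · rw [setOf_isMul_pow hS, hS.closedSpan_eq hb]
  · rw [IsCyclicVector, hS.closedSpan_eq hb]
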